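/- Consider finite simple undirected graphs whose vertices are colored with colors from a finite set, each vertex having one color, as structures with the adjacency relation and one unary relation for each color. First-order formulas (with equality) are taken in negation normal form, and the quantifier depth of a formula is the maximum number of nested quantifiers in it. For $i\ge 1$, let $\Sigma_i\cap\mathrm{FO}^2$ be the set of formulas that use at most two (reusable) variables and in which every sequence of nested quantifiers begins with $\exists$ and has at most $i-1$ quantifier alternations. A sentence distinguishes $G$ from $H$ if it is true on $G$ and false on $H$; let $D^2_{\Sigma_i}(G,H)$ be the minimum quantifier depth of a sentence in $\Sigma_i\cap\mathrm{FO}^2$ that distinguishes $G$ from $H$ ($\infty$ if there is none). There is a finite set of colors such that the following holds for every $i\ge 1$. There are infinitely many $n$ for which there exist colored graphs $G$ and $H$ over this set of colors, both on $n$ vertices, such that $G$ is distinguishable from $H$ in $\Sigma_i\cap\mathrm{FO}^2$ and $$D^2_{\Sigma_i}(G,H)>\frac{1}{11\cdot 9^i}\,n^2-\frac{1}{11\cdot 3^i}\,n.$$ -/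

import Mathlib

namespace ColoredFO

/-- An undirected simple graph on `V` whose vertices are colored with colors from `C`. -/
structure ColoredGraph (C V : Type) where
  graph : SimpleGraph V
  color : V → C

/-- The two kinds of quantifiers. -/
inductive Quant
  | ex
  | all
  deriving DecidableEq

/-- Atomic formulas over the vocabulary of colored graphs (equality, adjacency and one unary
relation for each color in `C`), with variables from `Fin k`. -/
inductive Atom (C : Type) (k : ℕ)
  | eq (x y : Fin k)
  | adj (x y : Fin k)
  | col (a : C) (x : Fin k)

/-- First-order formulas in negation normal form over the vocabulary of colored graphs that use
only the `k` variables in `Fin k`. A variable may be quantified repeatedly. -/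
inductive Formula (C : Type) (k : ℕ)
  | atom (α : Atom C k)
  | negAtom (α : Atom C k)
  | and (φ ψ : Formula C k)
  | or (φ ψ : Formula C k)
  | quant (q : Quant) (x : Fin k) (φ : Formula C k)

variable {C V W : Type} {k : ℕ}

/-- The variables occurring in an atomic formula. -/
def Atom.vars : Atom C k → Finset (Fin k)
  | .eq x y => {x, y}
  | .adj x y => {x, y}
  | .col _ x => {x}

/-- Truth of an atomic formula in `G` under the assignment `v`. -/
def Atom.Sat (G : ColoredGraph C V) (v : Fin k → V) : Atom C k → Prop
  | .eq x y => v x = v y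
  | .adj x y => G.graph.Adj (v x) (v y)
  | .col a x => G.color (v x) = a

namespace Formula

/-- The free variables of a formula. -/
def freeVars : Formula C k → Finset (Fin k)
  | atom α => α.vars
  | negAtom α => α.vars
  | and φ ψ => φ.freeVars ∪ ψ.freeVars
  | or φ ψ => φ.freeVars ∪ ψ.freeVars
  | quant _ x φ => φ.freeVars.erase x

/-- Truth of a formula in `G` under the assignment `v`. -/
def Sat (G : ColoredGraph C V) : (Fin k → V) → Formula C k → Prop
  | v, atom α => α.Sat G v
  | v, negAtom α => ¬ α.Sat G v
  | v, and φ ψ => Sat G v φ ∧ Sat G v ψ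
  | v, or φ ψ => Sat G v φ ∨ Sat G v ψ
  | v, quant .ex x φ => ∃ a : V, Sat G (Function.update v x a) φ
  | v, quant .all x φ => ∀ a : V, Sat G (Function.update v x a) φ

/-- The quantifier depth of a formula. -/
def depth : Formula C k → ℕ
  | atom _ => 0
  | negAtom _ => 0
  | and φ ψ => max φ.depth ψ.depth
  | or φ ψ => max φ.depth ψ.depth
  | quant _ _ φ => φ.depth + 1

/-- Every sequence of nested quantifiers of the formula begins with `q`, that is, each outermost
quantifier is `q`. -/
def BeginsWith (q : Quant) : Formula C k → Prop
  | atom _ => True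
  | negAtom _ => True
  | and φ ψ => φ.BeginsWith q ∧ ψ.BeginsWith q
  | or φ ψ => φ.BeginsWith q ∧ ψ.BeginsWith q
  | quant q' _ _ => q' = q

/-- The maximum number of quantifier alternations in a sequence consisting of `q` followed by
a sequence of nested quantifiers of the formula. If the formula begins with `q`, this is the
maximum number of alternations in a sequence of its nested quantifiers. -/
def alternations : Quant → Formula C k → ℕ
  | _, atom _ => 0
  | _, negAtom _ => 0
  | q, and φ ψ => max (φ.alternations q) (ψ.alternations q)
  | q, or φ ψ => max (φ.alternations q) (ψ.alternations q)
  | q, quant q' _ φ => (if q' = q then 0 else 1) + φ.alternations q'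

/-- A formula without free variables. -/
def IsSentence (φ : Formula C k) : Prop := φ.freeVars = ∅

/-- A sentence is true on `G`. Structures have nonempty universes, so that for a sentence it is
irrelevant whether all assignments or some assignment is used. -/
def TrueOn (φ : Formula C k) (G : ColoredGraph C V) : Prop := ∀ v : Fin k → V, φ.Sat G v

/-- `φ` is a sentence that is true on `G` but false on `H`. -/
def Distinguishes (φ : Formula C k) (G : ColoredGraph C V) (H : ColoredGraph C W) : Prop :=
  φ.IsSentence ∧ φ.TrueOn G ∧ ¬ φ.TrueOn H

end Formula

/-- The fragment `Σ_i ∩ FO^k`, for `i ≥ 1`: formulas with `k` variables in which every sequence of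
nested quantifiers begins with `∃` and has at most `i - 1` (that is, fewer than `i`)
alternations. -/
def sigmaFO (C : Type) (i k : ℕ) : Set (Formula C k) :=
  {φ | φ.BeginsWith .ex ∧ φ.alternations .ex < i}

/-- `G` is distinguishable from `H` in the fragment `L`. -/
def Distinguishable (L : Set (Formula C k)) (G : ColoredGraph C V) (H : ColoredGraph C W) : Prop :=
  ∃ φ ∈ L, φ.Distinguishes G H

/-- `D_L(G, H)`: the minimum quantifier depth of a formula in `L` distinguishing `G` from `H`;
it is `∞` if there is no such formula. -/
noncomputable def minDepth (L : Set (Formula C k)) (G : ColoredGraph C V) (H : ColoredGraph C W) :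
    ℕ∞ :=
  ⨅ φ ∈ {φ : Formula C k | φ ∈ L ∧ φ.Distinguishes G H}, (φ.depth : ℕ∞)

end ColoredFO

namespace ColoredFO

/-- The dual quantifier. -/
def Quant.dual : Quant → Quant
  | .ex => .all
  | .all => .ex

namespace Formula

variable {C V W : Type} {k : ℕ}

/-- The truth value of a formula depends only on the values of its free variables. -/
theorem sat_congr (G : ColoredGraph C V) (φ : Formula C k) :
    ∀ u v : Fin k → V, (∀ x ∈ φ.freeVars, u x = v x) → (φ.Sat G u ↔ φ.Sat G v) := by
  have hatom : ∀ (α : Atom C k) (u v : Fin k → V), (∀ x ∈ α.vars, u x = v x) →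
      (α.Sat G u ↔ α.Sat G v) := by
    intro α u v h
    cases α <;> simp_all [Atom.vars, Atom.Sat]
  have hquant : ∀ (φ : Formula C k) (x : Fin k) (u v : Fin k → V) (a : V),
      (∀ y ∈ φ.freeVars.erase x, u y = v y) →
      ∀ y ∈ φ.freeVars, Function.update u x a y = Function.update v x a y := by
    intro φ x u v a h y hy
    by_cases hyx : y = x
    · subst hyx; simp
    · simp [Function.update_of_ne hyx, h y (Finset.mem_erase.2 ⟨hyx, hy⟩)]
  induction φ with
  | atom α => exact fun u v h => hatom α u v h
  | negAtom α => exact fun u v h => not_congr (hatom α u v h)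
  | and φ ψ ihφ ihψ =>
    intro u v h
    exact and_congr (ihφ u v fun x hx => h x (Finset.mem_union_left _ hx))
      (ihψ u v fun x hx => h x (Finset.mem_union_right _ hx))
  | or φ ψ ihφ ihψ =>
    intro u v h
    exact or_congr (ihφ u v fun x hx => h x (Finset.mem_union_left _ hx))
      (ihψ u v fun x hx => h x (Finset.mem_union_right _ hx))
  | quant q x φ ih =>
    intro u v h
    cases q
    · exact exists_congr fun a => ih _ _ (hquant φ x u v a h)
    · exact forall_congr' fun a => ih _ _ (hquant φ x u v a h)

theorem IsSentence.sat_iff {φ : Formula C k} (hφ : φ.IsSentence) (G : ColoredGraph C V)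
    (u v : Fin k → V) : φ.Sat G u ↔ φ.Sat G v :=
  sat_congr G φ u v fun x hx => by rw [hφ] at hx; simp at hx

/-- The negation normal form of the negation. -/
def neg : Formula C k → Formula C k
  | atom α => negAtom α
  | negAtom α => atom α
  | and φ ψ => or φ.neg ψ.neg
  | or φ ψ => and φ.neg ψ.neg
  | quant q x φ => quant q.dual x φ.neg

theorem sat_neg (G : ColoredGraph C V) (φ : Formula C k) :
    ∀ v : Fin k → V, φ.neg.Sat G v ↔ ¬ φ.Sat G v := by
  induction φ with
  | atom α => exact fun v => Iff.rfl
  | negAtom α => exact fun v => not_not.symm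
  | and φ ψ ihφ ihψ => intro v; simp only [neg, Sat, ihφ, ihψ]; tauto
  | or φ ψ ihφ ihψ => intro v; simp only [neg, Sat, ihφ, ihψ]; tauto
  | quant q x φ ih => intro v; cases q <;> simp [neg, Sat, Quant.dual, ih]

theorem freeVars_neg (φ : Formula C k) : φ.neg.freeVars = φ.freeVars := by
  induction φ <;> simp_all [neg, freeVars]

theorem alternations_neg (φ : Formula C k) :
    ∀ q, φ.neg.alternations q = φ.alternations q.dual := by
  induction φ with
  | atom α => exact fun q => rfl
  | negAtom α => exact fun q => rfl
  | and φ ψ ihφ ihψ => intro q; simp [neg, alternations, ihφ, ihψ]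
  | or φ ψ ihφ ihψ => intro q; simp [neg, alternations, ihφ, ihψ]
  | quant q' x φ ih => intro q; cases q <;> cases q' <;> simp [neg, alternations, Quant.dual, ih]

theorem alternations_dual_le (φ : Formula C k) (q : Quant) :
    φ.alternations q.dual ≤ φ.alternations q + 1 := by
  induction φ with
  | atom α => simp [alternations]
  | negAtom α => simp [alternations]
  | and φ ψ ihφ ihψ => simp only [alternations]; omega
  | or φ ψ ihφ ihψ => simp only [alternations]; omega
  | quant q' x φ ih => cases q <;> cases q' <;> simp [alternations, Quant.dual] <;> omega

end Formula

/-- The pullback of a colored graph along a bijection of the vertices. -/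
def ColoredGraph.comap {C V W : Type} (e : W ≃ V) (G : ColoredGraph C V) : ColoredGraph C W where
  graph := G.graph.comap e
  color := G.color ∘ e

namespace Formula

variable {C V W : Type} {k : ℕ}

theorem sat_comap (e : W ≃ V) (G : ColoredGraph C V) (φ : Formula C k) :
    ∀ v : Fin k → W, φ.Sat (G.comap e) v ↔ φ.Sat G (e ∘ v) := by
  have hatom : ∀ (α : Atom C k) (v : Fin k → W), α.Sat (G.comap e) v ↔ α.Sat G (e ∘ v) := by
    intro α v
    cases α <;> simp [Atom.Sat, ColoredGraph.comap]
  induction φ with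
  | atom α => exact hatom α
  | negAtom α => exact fun v => not_congr (hatom α v)
  | and φ ψ ihφ ihψ => exact fun v => and_congr (ihφ v) (ihψ v)
  | or φ ψ ihφ ihψ => exact fun v => or_congr (ihφ v) (ihψ v)
  | quant q x φ ih =>
    intro v
    cases q
    · simp only [Sat, ih, Function.comp_update]
      exact e.exists_congr_left.trans (by simp)
    · simp only [Sat, ih, Function.comp_update]
      exact e.forall_congr_left.trans (by simp)

theorem trueOn_comap (e : W ≃ V) (G : ColoredGraph C V) (φ : Formula C k) :
    φ.TrueOn (G.comap e) ↔ φ.TrueOn G := by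
  constructor
  · intro h v
    have := (sat_comap e G φ _).1 (h (e.symm ∘ v))
    rwa [← Function.comp_assoc, e.self_comp_symm, Function.id_comp] at this
  · exact fun h v => (sat_comap e G φ v).2 (h _)

theorem distinguishes_comap {V' W' : Type} (e : W ≃ V) (e' : W' ≃ V') (G : ColoredGraph C V)
    (H : ColoredGraph C V') (φ : Formula C k) :
    φ.Distinguishes (G.comap e) (H.comap e') ↔ φ.Distinguishes G H := by
  simp only [Distinguishes, trueOn_comap]

end Formula

/-- The minimum depth is a natural number if there is a distinguishing formula, and every
lower bound on the depth of the distinguishing formulas is a lower bound for it. -/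
theorem exists_minDepth_eq {C V W : Type} {k : ℕ} {L : Set (Formula C k)} {G : ColoredGraph C V}
    {H : ColoredGraph C W} (h : Distinguishable L G H) (R : ℕ)
    (hR : ∀ φ ∈ L, φ.Distinguishes G H → R ≤ φ.depth) :
    ∃ d : ℕ, minDepth L G H = (d : ℕ∞) ∧ R ≤ d := by
  obtain ⟨φ, hφ, hd⟩ := h
  have hle : minDepth L G H ≤ (φ.depth : ℕ∞) := iInf₂_le φ ⟨hφ, hd⟩
  have hne : minDepth L G H ≠ ⊤ := fun h => by simp [h] at hle
  obtain ⟨d, hd'⟩ := ENat.ne_top_iff_exists.1 hne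
  refine ⟨d, hd'.symm, ?_⟩
  have : (R : ℕ∞) ≤ minDepth L G H := le_iInf₂ fun ψ hψ => by
    exact_mod_cast hR ψ hψ.1 hψ.2
  rw [← hd'] at this
  exact_mod_cast this

section Game

variable {C V : Type}

/-- A position of the two-pebble game on a pair of graphs in which corresponding pebbles are
similar and the pebbled vertices form a partial isomorphism. -/
def Position (G H : ColoredGraph C V) (S : V → V → Prop) (u v : Fin 2 → V) : Prop :=
  (∀ x, S (u x) (v x)) ∧
    ∀ x y, (u x = u y ↔ v x = v y) ∧ (G.graph.Adj (u x) (u y) ↔ H.graph.Adj (v x) (v y))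

/-- A family of similarity relations `S s r X Y` between the vertices of `G X` and those of `G Y`
that is a strategy for Duplicator in the two-pebble game with at most `s` blocks of moves and
at most `r` moves, where the first block is played in `G X`. -/
structure Strategy {B : Type} (G : B → ColoredGraph C V)
    (S : ℕ → ℕ → B → B → V → V → Prop) : Prop where
  color_eq : ∀ {s r X Y x y}, S s r X Y x y → (G X).color x = (G Y).color y
  mono : ∀ {s r X Y x y}, S s (r + 1) X Y x y → S s r X Y x y
  swap : ∀ {s r X Y x y}, 1 ≤ s → S (s + 1) r X Y x y → S s r Y X y x
  forth : ∀ {s r X Y x y}, 1 ≤ s → S s (r + 1) X Y x y → ∀ x', ∃ y', S s r X Y x' y' ∧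
    (x = x' ↔ y = y') ∧ ((G X).graph.Adj x x' ↔ (G Y).graph.Adj y y')

variable {B : Type} {G : B → ColoredGraph C V} {S : ℕ → ℕ → B → B → V → V → Prop}

theorem Position.symm {G H : ColoredGraph C V} {S T : V → V → Prop} {u v : Fin 2 → V}
    (h : Position G H S u v) (hST : ∀ x y, S x y → T y x) : Position H G T v u :=
  ⟨fun x => hST _ _ (h.1 x), fun x y => ⟨(h.2 x y).1.symm, (h.2 x y).2.symm⟩⟩

theorem Strategy.exists_position (hS : Strategy G S) {s r : ℕ} {X Y : B} {u v : Fin 2 → V}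
    (hs : 1 ≤ s) (h : Position (G X) (G Y) (S s (r + 1) X Y) u v) (x : Fin 2) (a : V) :
    ∃ b, Position (G X) (G Y) (S s r X Y) (Function.update u x a) (Function.update v x b) := by
  obtain ⟨b, hb, heq, hadj⟩ := hS.forth hs (h.1 (1 - x)) a
  refine ⟨b, ?_⟩
  have h0 := hS.mono (h.1 (1 - x))
  have ha := (G X).graph.adj_comm a (u (1 - x))
  have hb' := (G Y).graph.adj_comm b (v (1 - x))
  have ea : a = u (1 - x) ↔ u (1 - x) = a := eq_comm
  have eb : b = v (1 - x) ↔ v (1 - x) = b := eq_comm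
  fin_cases x <;>
    simp [Position, Fin.forall_fin_two] at * <;> simp_all

theorem Strategy.sat_atom (hS : Strategy G S) {s r : ℕ} {X Y : B} {u v : Fin 2 → V}
    (h : Position (G X) (G Y) (S s r X Y) u v) (α : Atom C 2) :
    α.Sat (G X) u ↔ α.Sat (G Y) v := by
  cases α with
  | eq x y => exact (h.2 x y).1
  | adj x y => exact (h.2 x y).2
  | col a x => exact iff_of_eq (congrArg (· = a) (hS.color_eq (h.1 x)))

theorem Strategy.sat_imp (hS : Strategy G S) (φ : Formula C 2) :
    ∀ (q : Quant) (s r : ℕ) (X Y : B) (u v : Fin 2 → V), φ.depth ≤ r → φ.alternations q < s →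
      (q = .ex → Position (G X) (G Y) (S s r X Y) u v) →
      (q = .all → Position (G Y) (G X) (S s r Y X) v u) →
      φ.Sat (G X) u → φ.Sat (G Y) v := by
  have hatom : ∀ (α : Atom C 2) (q : Quant) (s r : ℕ) (X Y : B) (u v : Fin 2 → V),
      (q = .ex → Position (G X) (G Y) (S s r X Y) u v) →
      (q = .all → Position (G Y) (G X) (S s r Y X) v u) →
      (α.Sat (G X) u ↔ α.Sat (G Y) v) := by
    intro α q s r X Y u v h1 h2
    cases q
    · exact hS.sat_atom (h1 rfl) α
    · exact (hS.sat_atom (h2 rfl) α).symm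
  induction φ with
  | atom α =>
    intro q s r X Y u v _ _ h1 h2
    exact (hatom α q s r X Y u v h1 h2).1
  | negAtom α =>
    intro q s r X Y u v _ _ h1 h2
    exact (not_congr (hatom α q s r X Y u v h1 h2)).1
  | and φ ψ ihφ ihψ =>
    intro q s r X Y u v hr hs h1 h2 h
    simp only [Formula.depth, Formula.alternations, max_le_iff, max_lt_iff] at hr hs
    exact ⟨ihφ q s r X Y u v hr.1 hs.1 h1 h2 h.1, ihψ q s r X Y u v hr.2 hs.2 h1 h2 h.2⟩
  | or φ ψ ihφ ihψ =>
    intro q s r X Y u v hr hs h1 h2 h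
    simp only [Formula.depth, Formula.alternations, max_le_iff, max_lt_iff] at hr hs
    exact h.imp (ihφ q s r X Y u v hr.1 hs.1 h1 h2) (ihψ q s r X Y u v hr.2 hs.2 h1 h2)
  | quant q' x φ ih =>
    have key : ∀ (s r : ℕ) (X Y : B) (u v : Fin 2 → V), φ.depth + 1 ≤ r →
        φ.alternations q' < s →
        (q' = .ex → Position (G X) (G Y) (S s r X Y) u v) →
        (q' = .all → Position (G Y) (G X) (S s r Y X) v u) →
        (Formula.quant q' x φ).Sat (G X) u → (Formula.quant q' x φ).Sat (G Y) v := by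
      intro s r X Y u v hr hs h1 h2 h
      obtain ⟨r, rfl⟩ : ∃ r', r = r' + 1 := ⟨r - 1, by omega⟩
      cases q'
      · obtain ⟨a, ha⟩ := h
        obtain ⟨b, hb⟩ := hS.exists_position (by omega) (h1 rfl) x a
        exact ⟨b, ih .ex s r X Y _ _ (by omega) hs (fun _ => hb) (by simp) ha⟩
      · intro b
        obtain ⟨a, ha⟩ := hS.exists_position (by omega) (h2 rfl) x b
        exact ih .all s r X Y _ _ (by omega) hs (by simp) (fun _ => ha) (h a)
    intro q s r X Y u v hr hs h1 h2
    by_cases hq : q' = q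
    · subst hq
      simp only [Formula.depth, Formula.alternations, if_true, zero_add] at hr hs
      exact key s r X Y u v hr hs h1 h2
    · simp only [Formula.depth, Formula.alternations, if_neg hq] at hr hs
      obtain ⟨s, rfl⟩ : ∃ s', s = s' + 1 := ⟨s - 1, by omega⟩
      refine key s r X Y u v hr (by omega) (fun h => ?_) (fun h => ?_)
      · have : q = .all := by cases q <;> simp_all
        exact (h2 this).symm fun _ _ => hS.swap (by omega)
      · have : q = .ex := by cases q <;> simp_all
        exact (h1 this).symm fun _ _ => hS.swap (by omega)

/-- A formula of `Σ_s ∩ FO²` that distinguishes `G X` from `G Y` has depth larger than the number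
of moves that Duplicator survives. -/
theorem Strategy.lt_depth (hS : Strategy G S) {s r : ℕ} {X Y : B} {x y : V}
    (h : S s r X Y x y) {φ : Formula C 2} (hφ : φ ∈ sigmaFO C s 2)
    (hd : φ.Distinguishes (G X) (G Y)) : r < φ.depth := by
  by_contra hr
  obtain ⟨hsent, hX, hY⟩ := hd
  apply hY
  intro v
  refine (hsent.sat_iff (G Y) (fun _ => y) v).1 ?_
  exact hS.sat_imp φ .ex s r X Y (fun _ => x) (fun _ => y) (by omega) hφ.2
    (fun _ => ⟨fun _ => h, fun _ _ => by simp⟩) (by simp) (hX _)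

end Game

/-- The label of the `c`-th child of a node labeled `b`. -/
def childLabel (b : Bool) (c : Fin 3) : Bool := !(b && decide (c = 2))

/-- The vertices other than the root of a ternary tree of height `i` in which a copy of `Γ` is
attached to each leaf. -/
def Sub (Γ : Type) : ℕ → Type
  | 0 => Γ
  | i + 1 => Fin 3 × Option (Sub Γ i)

/-- The vertices of a ternary tree of height `i` in which a copy of `Γ` is attached to each leaf;
the root is `none`. -/
abbrev Vert (Γ : Type) (i : ℕ) : Type := Option (Sub Γ i)

section Tree

variable {C Γ : Type}

theorem child_inj {i : ℕ} {c d : Fin 3} {x y : Vert Γ i} :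
    (some (c, x) : Vert Γ (i + 1)) = some (d, y) ↔ c = d ∧ x = y :=
  Option.some_inj.trans Prod.mk_inj

/-- Adjacency in the tree with a root labeled `b`, where all vertices of `base b'` are
adjacent to their leaf of label `b'`. -/
def treeAdj (base : Bool → ColoredGraph C Γ) : (i : ℕ) → Bool → Vert Γ i → Vert Γ i → Prop
  | _, _, none, none => False
  | 0, _, none, some _ => True
  | 0, _, some _, none => True
  | 0, b, some x, some y => (base b).graph.Adj x y
  | _ + 1, _, none, some y => y.2 = none
  | _ + 1, _, some x, none => x.2 = none
  | i + 1, b, some x, some y => x.1 = y.1 ∧ treeAdj base i (childLabel b x.1) x.2 y.2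

theorem treeAdj_symm (base : Bool → ColoredGraph C Γ) :
    ∀ (i : ℕ) (b : Bool) (x y : Vert Γ i), treeAdj base i b x y → treeAdj base i b y x
  | 0, _, none, none, h => h
  | _ + 1, _, none, none, h => h
  | 0, _, none, some _, h => h
  | 0, _, some _, none, h => h
  | 0, b, some _, some _, h => (base b).graph.adj_symm h
  | _ + 1, _, none, some _, h => h
  | _ + 1, _, some _, none, h => h
  | i + 1, b, some x, some y, h => by
    obtain ⟨h1, h2⟩ := h
    exact ⟨h1.symm, by rw [← h1]; exact treeAdj_symm base i _ _ _ h2⟩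

theorem treeAdj_irrefl (base : Bool → ColoredGraph C Γ) :
    ∀ (i : ℕ) (b : Bool) (x : Vert Γ i), ¬ treeAdj base i b x x
  | 0, _, none, h => h
  | _ + 1, _, none, h => h
  | 0, b, some _, h => (base b).graph.loopless.irrefl _ h
  | i + 1, _, some _, h => treeAdj_irrefl base i _ _ h.2

/-- The color of a vertex of the tree, where the root has color `κ` and every other node at
height `j` has color `lev j`. -/
def treeColor (base : Bool → ColoredGraph C Γ) (lev : ℕ → C) :
    (i : ℕ) → Bool → C → Vert Γ i → C
  | _, _, κ, none => κ
  | 0, b, _, some x => (base b).color x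
  | i + 1, b, _, some x => treeColor base lev i (childLabel b x.1) (lev i) x.2

/-- The tree with a root labeled `b`. -/
def tree (base : Bool → ColoredGraph C Γ) (lev : ℕ → C) (i : ℕ) (b : Bool) (κ : C) :
    ColoredGraph C (Vert Γ i) where
  graph :=
    { Adj := treeAdj base i b
      symm := ⟨treeAdj_symm base i b⟩
      loopless := ⟨treeAdj_irrefl base i b⟩ }
  color := treeColor base lev i b κ

/-- Nodes at height `i` labeled `X` and `Y` are indistinguishable by `s` blocks of moves starting
in the first tree, up to the number of moves for which `base false` and `base true` are. -/
def Allowed (i s : ℕ) (X Y : Bool) : Prop :=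
  (X = true → Y = false → s ≤ i) ∧ (X = false → Y = true → s ≤ i + 1)

theorem Allowed.swap {i s : ℕ} {X Y : Bool} (h : Allowed i (s + 1) X Y) : Allowed i s Y X :=
  ⟨fun hY hX => by have := h.2 hX hY; omega, fun hY hX => by have := h.1 hX hY; omega⟩

theorem exists_child {i s : ℕ} {X Y : Bool} (h : Allowed (i + 1) s X Y) (c : Fin 3) :
    ∃ d, (X = Y → childLabel X c = childLabel Y d) ∧
      Allowed i s (childLabel X c) (childLabel Y d) := by
  cases X <;> cases Y <;> fin_cases c <;>
    simp [Allowed, childLabel, Fin.exists_fin_succ] at *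
  omega

theorem exists_child_ne {i s : ℕ} {X Y : Bool} (h : Allowed (i + 1) s X Y) {c d : Fin 3}
    (hcd : X = Y → childLabel X c = childLabel Y d) {c' : Fin 3} (hc : c ≠ c') :
    ∃ d', d ≠ d' ∧ (X = Y → childLabel X c' = childLabel Y d') ∧
      Allowed i s (childLabel X c') (childLabel Y d') := by
  cases X <;> cases Y <;> fin_cases c <;> fin_cases d <;> fin_cases c' <;>
    simp [Allowed, childLabel, Fin.exists_fin_succ] at * <;> omega

/-- The similarity of vertices of two trees in terms of a family `Q` of similarities between the
vertices of `base false` and those of `base true`. -/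
def Similar (Q : ℕ → Γ → Γ → Prop) :
    (i s r : ℕ) → Bool → Bool → Vert Γ i → Vert Γ i → Prop
  | i, s, _, X, Y, none, none => Allowed i s X Y
  | 0, s, r, X, Y, some x, some y =>
    Allowed 0 s X Y ∧ (X = Y → x = y) ∧ (X = false → Y = true → Q r x y)
  | i + 1, s, r, X, Y, some x, some y =>
    Allowed (i + 1) s X Y ∧ (X = Y → childLabel X x.1 = childLabel Y y.1) ∧
      Similar Q i s r (childLabel X x.1) (childLabel Y y.1) x.2 y.2
  | _, _, _, _, _, none, some _ => False
  | _, _, _, _, _, some _, none => False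

/-- A family `Q` of similarities between the vertices of `A` and those of `B` that is a strategy
for Duplicator to survive `R` moves of the existential two-pebble game, from every first move. -/
structure ExStrategy (A B : ColoredGraph C Γ) (R : ℕ) (Q : ℕ → Γ → Γ → Prop) : Prop where
  color_eq : ∀ {r x y}, Q r x y → A.color x = B.color y
  mono : ∀ {r x y}, Q (r + 1) x y → Q r x y
  start : ∀ {r}, r ≤ R → ∀ x, ∃ y, Q r x y
  forth : ∀ {r x y}, r ≤ R → Q (r + 1) x y → ∀ x', ∃ y', Q r x' y' ∧
    (x = x' ↔ y = y') ∧ (A.graph.Adj x x' ↔ B.graph.Adj y y')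

variable {base : Bool → ColoredGraph C Γ} {lev : ℕ → C} {Q : ℕ → Γ → Γ → Prop} {R : ℕ}

theorem Similar.allowed {i s r : ℕ} {X Y : Bool} {x y : Vert Γ i}
    (h : Similar Q i s r X Y x y) : Allowed i s X Y := by
  cases i <;> cases x <;> cases y <;> simp only [Similar] at h
  exacts [h, h.1, h, h.1]

theorem Similar.eq_none_iff {i s r : ℕ} {X Y : Bool} {x y : Vert Γ i}
    (h : Similar Q i s r X Y x y) : x = none ↔ y = none := by
  cases i <;> cases x <;> cases y <;> simp_all [Similar]

theorem similar_none {i s r : ℕ} {X Y : Bool} (h : Allowed i s X Y) :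
    Similar Q i s r X Y none none := by
  cases i <;> exact h

theorem Similar.mono (hQ : ExStrategy (base false) (base true) R Q) :
    ∀ {i s r : ℕ} {X Y : Bool} {x y : Vert Γ i},
      Similar Q i s (r + 1) X Y x y → Similar Q i s r X Y x y
  | 0, _, _, _, _, none, none, h => h
  | _ + 1, _, _, _, _, none, none, h => h
  | 0, _, _, _, _, some _, some _, h => ⟨h.1, h.2.1, fun hX hY => hQ.mono (h.2.2 hX hY)⟩
  | _ + 1, _, _, _, _, some _, some _, h => ⟨h.1, h.2.1, Similar.mono hQ h.2.2⟩
  | 0, _, _, _, _, none, some _, h => h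
  | 0, _, _, _, _, some _, none, h => h
  | _ + 1, _, _, _, _, none, some _, h => h
  | _ + 1, _, _, _, _, some _, none, h => h

theorem Similar.swap :
    ∀ {i s r : ℕ} {X Y : Bool} {x y : Vert Γ i}, 1 ≤ s →
      Similar Q i (s + 1) r X Y x y → Similar Q i s r Y X y x
  | 0, _, _, _, _, none, none, _, h => Allowed.swap h
  | _ + 1, _, _, _, _, none, none, _, h => Allowed.swap h
  | 0, _, _, _, _, some _, some _, hs, h =>
    ⟨h.1.swap, fun e => (h.2.1 e.symm).symm, fun hY hX => by have := h.1.1 hX hY; omega⟩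
  | _ + 1, _, _, _, _, some _, some _, hs, h =>
    ⟨h.1.swap, fun e => (h.2.1 e.symm).symm, Similar.swap hs h.2.2⟩
  | 0, _, _, _, _, none, some _, _, h => h
  | 0, _, _, _, _, some _, none, _, h => h
  | _ + 1, _, _, _, _, none, some _, _, h => h
  | _ + 1, _, _, _, _, some _, none, _, h => h

theorem Similar.color_eq (hQ : ExStrategy (base false) (base true) R Q) :
    ∀ {i s r : ℕ} {X Y : Bool} {x y : Vert Γ i} (κ : C), 1 ≤ s → Similar Q i s r X Y x y →
      treeColor base lev i X κ x = treeColor base lev i Y κ y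
  | 0, _, _, _, _, none, none, _, _, _ => rfl
  | _ + 1, _, _, _, _, none, none, _, _, _ => rfl
  | 0, s, _, X, Y, some x, some y, _, hs, ⟨h1, h2, h3⟩ => by
    simp only [treeColor]
    cases X <;> cases Y
    · rw [h2 rfl]
    · exact hQ.color_eq (h3 rfl rfl)
    · have := h1.1 rfl rfl; omega
    · rw [h2 rfl]
  | i + 1, _, _, _, _, some _, some _, _, hs, h => by
    have := Similar.color_eq hQ (lev i) hs h.2.2
    exact this
  | 0, _, _, _, _, none, some _, _, _, h => h.elim
  | 0, _, _, _, _, some _, none, _, _, h => h.elim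
  | _ + 1, _, _, _, _, none, some _, _, _, h => h.elim
  | _ + 1, _, _, _, _, some _, none, _, _, h => h.elim

theorem Similar.start (hQ : ExStrategy (base false) (base true) R Q) :
    ∀ {i s r : ℕ} {X Y : Bool}, 1 ≤ s → r ≤ R → Allowed i s X Y → ∀ x : Vert Γ i,
      ∃ y, Similar Q i s r X Y x y
  | 0, _, _, _, _, _, _, h, none => ⟨none, h⟩
  | _ + 1, _, _, _, _, _, _, h, none => ⟨none, h⟩
  | 0, s, r, X, Y, hs, hr, h, some x => by
    cases X <;> cases Y
    · exact ⟨some x, h, by simp, by simp⟩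
    · obtain ⟨y, hy⟩ := hQ.start hr x
      exact ⟨some y, h, by simp, fun _ _ => hy⟩
    · have := h.1 rfl rfl; omega
    · exact ⟨some x, h, by simp, by simp⟩
  | i + 1, s, r, X, Y, hs, hr, h, some (c, x) => by
    obtain ⟨d, hd, hall⟩ := exists_child h c
    obtain ⟨y, hy⟩ := Similar.start hQ hs hr hall x
    exact ⟨some (d, y), h, hd, hy⟩

theorem Similar.forth (hQ : ExStrategy (base false) (base true) R Q) :
    ∀ {i s r : ℕ} {X Y : Bool} {x y : Vert Γ i}, 1 ≤ s → r ≤ R →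
      Similar Q i s (r + 1) X Y x y → ∀ x' : Vert Γ i, ∃ y', Similar Q i s r X Y x' y' ∧
        (x = x' ↔ y = y') ∧ (treeAdj base i X x x' ↔ treeAdj base i Y y y')
  | 0, s, r, X, Y, none, none, hs, hr, h, none => ⟨none, h, by simp, by simp [treeAdj]⟩
  | i + 1, s, r, X, Y, none, none, hs, hr, h, none => ⟨none, h, by simp, by simp [treeAdj]⟩
  | 0, s, r, X, Y, none, none, hs, hr, h, some x' => by
    obtain ⟨y', hy'⟩ := Similar.start (r := r) hQ hs hr h.allowed (some x')
    obtain _ | y' := y'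
    · exact hy'.elim
    · exact ⟨some y', hy', by simp, by simp [treeAdj]⟩
  | i + 1, s, r, X, Y, none, none, hs, hr, h, some x' => by
    obtain ⟨y', hy'⟩ := Similar.start (r := r) hQ hs hr h.allowed (some x')
    obtain _ | y' := y'
    · exact hy'.elim
    · exact ⟨some y', hy', by simp, by simpa [treeAdj] using hy'.2.2.eq_none_iff⟩
  | 0, s, r, X, Y, some x, some y, hs, hr, h, none =>
    ⟨none, h.allowed, by simp, by simp [treeAdj]⟩
  | i + 1, s, r, X, Y, some x, some y, hs, hr, h, none =>
    ⟨none, h.allowed, by simp, by simpa [treeAdj] using h.2.2.eq_none_iff⟩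
  | 0, s, r, X, Y, some x, some y, hs, hr, ⟨h1, h2, h3⟩, some x' => by
    have same : X = Y → ∃ y', Similar Q 0 s r X Y (some x') y' ∧
        ((some x : Vert Γ 0) = some x' ↔ (some y : Vert Γ 0) = y') ∧
        (treeAdj base 0 X (some x) (some x') ↔ treeAdj base 0 Y (some y) y') := by
      rintro rfl
      obtain rfl := h2 rfl
      exact ⟨some x', ⟨h1, by simp, by simp_all⟩, by simp, by simp⟩
    cases X <;> cases Y
    · exact same rfl
    · obtain ⟨y', hy', heq, hadj⟩ := hQ.forth hr (h3 rfl rfl) x'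
      exact ⟨some y', ⟨h1, by simp, fun _ _ => hy'⟩,
        (Option.some_inj.trans heq).trans Option.some_inj.symm, hadj⟩
    · have := h1.1 rfl rfl; omega
    · exact same rfl
  | i + 1, s, r, X, Y, some (c, x), some (d, y), hs, hr, ⟨h1, h2, h3⟩, some (c', x') => by
    by_cases hc : c = c'
    · subst hc
      obtain ⟨y', hy', heq, hadj⟩ := Similar.forth hQ hs hr h3 x'
      refine ⟨some (d, y'), ⟨h1, h2, hy'⟩, ?_, ?_⟩
      · exact child_inj.trans ((and_congr_right fun _ => heq).trans
          ((and_congr_left' (by simp)).trans (child_inj (c := d) (d := d)).symm))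
      · simpa [treeAdj] using hadj
    · obtain ⟨d', hne, hd', hall⟩ := exists_child_ne h1 h2 hc
      obtain ⟨y', hy'⟩ := Similar.start hQ hs hr hall x'
      refine ⟨some (d', y'), ⟨h1, hd', hy'⟩, ?_, ?_⟩
      · exact iff_of_false (fun e => hc (child_inj.1 e).1) (fun e => hne (child_inj.1 e).1)
      · simp [treeAdj, hc, hne]
  | 0, _, _, _, _, none, some _, _, _, h, _ => h.elim
  | 0, _, _, _, _, some _, none, _, _, h, _ => h.elim
  | _ + 1, _, _, _, _, none, some _, _, _, h, _ => h.elim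
  | _ + 1, _, _, _, _, some _, none, _, _, h, _ => h.elim

/-- Duplicator's strategy on a pair of trees. -/
theorem strategy_tree (hQ : ExStrategy (base false) (base true) R Q) (i : ℕ) (κ : C) :
    Strategy (fun b => tree base lev i b κ)
      (fun s r X Y x y => (1 ≤ s ∧ r ≤ R) ∧ Similar Q i s r X Y x y) where
  color_eq h := Similar.color_eq hQ κ h.1.1 h.2
  mono h := ⟨⟨h.1.1, by omega⟩, h.2.mono hQ⟩
  swap hs h := ⟨⟨hs, h.1.2⟩, h.2.swap hs⟩
  forth hs h x' := by
    obtain ⟨y', h1, h2⟩ := Similar.forth hQ hs (by omega) h.2 x'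
    exact ⟨y', ⟨⟨hs, by omega⟩, h1⟩, h2⟩

/-- A formula of `Σ_i ∩ FO²` that distinguishes the trees of height `i` with roots labeled `true`
and `false` has large depth. -/
theorem lt_depth_of_distinguishes_tree (hQ : ExStrategy (base false) (base true) R Q) {i : ℕ}
    (hi : 1 ≤ i) (κ : C) {φ : Formula C 2} (hφ : φ ∈ sigmaFO C i 2)
    (hd : φ.Distinguishes (tree base lev i true κ) (tree base lev i false κ)) : R < φ.depth :=
  (strategy_tree hQ i κ).lt_depth (X := true) (Y := false) (x := none) (y := none)
    ⟨⟨hi, le_rfl⟩, similar_none ⟨fun _ _ => le_rfl, by simp⟩⟩ hφ hd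

end Tree

theorem nat_card_vert (Γ : Type) [Fintype Γ] :
    ∀ i, Finite (Sub Γ i) ∧ 2 * Nat.card (Vert Γ i) + 1 = 3 ^ i * (2 * Fintype.card Γ + 3)
  | 0 => by
    refine ⟨inferInstanceAs (Finite Γ), ?_⟩
    have : Nat.card (Vert Γ 0) = Fintype.card Γ + 1 := by
      rw [← Nat.card_eq_fintype_card]; exact Finite.card_option (α := Γ)
    rw [this]; ring
  | i + 1 => by
    obtain ⟨h1, h2⟩ := nat_card_vert Γ i
    refine ⟨inferInstanceAs (Finite (Fin 3 × Option (Sub Γ i))), ?_⟩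
    have : Nat.card (Vert Γ (i + 1)) = 3 * Nat.card (Vert Γ i) + 1 := by
      refine (Finite.card_option (α := Fin 3 × Option (Sub Γ i))).trans ?_
      rw [Nat.card_prod, Nat.card_fin]
    rw [this, pow_succ]; linarith

/-- The color of a vertex of a cycle at position `z` that is marked or not. -/
def cycleColor (z : ℤ) (marked : Bool) : Fin 10 :=
  ⟨((z % 3).toNat + if marked then 3 else 0), by split <;> omega⟩

theorem cycleColor_eq_iff {z z' : ℤ} {b b' : Bool} :
    cycleColor z b = cycleColor z' b' ↔ z % 3 = z' % 3 ∧ b = b' := by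
  simp only [cycleColor, Fin.mk.injEq]
  cases b <;> cases b' <;> simp <;> omega

/-- The color of the nodes at height `j`. -/
def levelColor (j : ℕ) : Fin 10 := ⟨6 + j % 3, by omega⟩

theorem levelColor_eq_iff {j k : ℕ} : levelColor j = levelColor k ↔ j % 3 = k % 3 := by
  simp only [levelColor, Fin.mk.injEq]; omega

theorem cycleColor_ne_levelColor (z : ℤ) (b : Bool) (j : ℕ) : cycleColor z b ≠ levelColor j := by
  simp only [cycleColor, levelColor, ne_eq, Fin.mk.injEq]
  split <;> omega

theorem cycleColor_ne_nine (z : ℤ) (b : Bool) : cycleColor z b ≠ 9 := by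
  simp only [cycleColor, ne_eq, Fin.ext_iff]
  split <;> simp <;> omega

theorem levelColor_ne_nine (j : ℕ) : levelColor j ≠ 9 := by
  simp only [levelColor, ne_eq, Fin.ext_iff]
  simp; omega

/-- A cycle of length `3k` whose vertices may have been multiplied. -/
def cycle {Γ : Type} (k : ℤ) (pos : Γ → ℤ) (marked : Γ → Bool) : ColoredGraph (Fin 10) Γ where
  graph :=
    { Adj := fun x y => 3 * k ∣ pos y - pos x - 1 ∨ 3 * k ∣ pos x - pos y - 1
      symm := ⟨fun _ _ h => h.symm⟩
      loopless := ⟨fun x h => by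
        have : (3 : ℤ) ∣ pos x - pos x - 1 := (dvd_mul_right 3 k).trans (h.elim id id)
        omega⟩ }
  color x := cycleColor (pos x) (marked x)

/-- The cycle of length `12t+3` with one marked vertex. -/
def longCycle (t : ℕ) : ColoredGraph (Fin 10) (Fin (12 * t + 3)) :=
  cycle (4 * t + 1) (fun x => (x : ℕ)) (fun x => decide ((x : ℕ) = 0))

/-- The position of a vertex in the short cycle. -/
def shortPos (t : ℕ) (x : Fin (12 * t + 3)) : ℤ :=
  if (x : ℕ) < 9 * t + 3 then (x : ℕ) else 3 * ((x : ℕ) - (9 * t + 2))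

/-- The cycle of length `9t+3` where each position other than `0` that is divisible by `3` is
occupied both by a marked and by an unmarked vertex. -/
def shortCycle (t : ℕ) : ColoredGraph (Fin 10) (Fin (12 * t + 3)) :=
  cycle (3 * t + 1) (shortPos t) (fun x => decide (9 * t + 3 ≤ (x : ℕ)))

/-- Vertices `x` of the long cycle and `y` of the short cycle that are reached by a walk which is
at least `r` steps away from the only place where Duplicator loses. -/
def CycleSimilar (t r : ℕ) (x y : Fin (12 * t + 3)) : Prop :=
  ∃ τ : ℤ, r + 1 ≤ τ ∧ τ ≤ 3 * (4 * t + 1) * (3 * t + 1) - r - 1 ∧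
    3 * (4 * (t : ℤ) + 1) ∣ τ - (x : ℕ) ∧ 3 * (3 * (t : ℤ) + 1) ∣ τ - shortPos t y ∧
      ((x : ℕ) = 0 ↔ 9 * t + 3 ≤ (y : ℕ))

theorem not_dvd_of_dvd {t τ : ℤ} (h0 : 1 ≤ τ) (hτ : τ ≤ 3 * (4 * t + 1) * (3 * t + 1) - 1)
    (h : 3 * (4 * t + 1) ∣ τ) : ¬ 3 * (3 * t + 1) ∣ τ := by
  rintro ⟨b, hb⟩
  obtain ⟨a, ha⟩ := h
  have hd : 3 * (4 * t + 1) * (3 * t + 1) ∣ τ := by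
    refine ⟨4 * a - 3 * b, ?_⟩
    linear_combination (4 * (3 * t + 1)) * ha - (3 * (4 * t + 1)) * hb
  have := Int.le_of_dvd (by omega) hd
  omega

/-- Every walk that has not yet reached the losing place can be mapped to the short cycle. -/
theorem exists_short (t : ℕ) {τ : ℤ} (h0 : 1 ≤ τ) (hτ : τ ≤ 3 * (4 * t + 1) * (3 * t + 1) - 1)
    {x : Fin (12 * t + 3)} (hx : 3 * (4 * (t : ℤ) + 1) ∣ τ - (x : ℕ)) :
    ∃ y, 3 * (3 * (t : ℤ) + 1) ∣ τ - shortPos t y ∧ ((x : ℕ) = 0 ↔ 9 * t + 3 ≤ (y : ℕ)) := by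
  have hq : (0 : ℤ) < 3 * (3 * t + 1) := by positivity
  have hdiv := Int.emod_add_mul_ediv τ (3 * (3 * t + 1))
  have hlt := Int.emod_lt_of_pos τ hq
  have hnn := Int.emod_nonneg τ hq.ne'
  set m := τ % (3 * (3 * t + 1)) with hm
  have hdvd : 3 * (3 * (t : ℤ) + 1) ∣ τ - m := ⟨_, by linarith⟩
  by_cases h : (x : ℕ) = 0
  · have hp : 3 * (4 * (t : ℤ) + 1) ∣ τ := by simpa [h] using hx
    have hne : m ≠ 0 := fun h => not_dvd_of_dvd h0 hτ hp (by simpa [h] using hdvd)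
    have h3 : (3 : ℤ) ∣ m := by
      have h1 := (dvd_mul_right (3 : ℤ) _).trans hp
      have h2 := (dvd_mul_right (3 : ℤ) _).trans hdvd
      omega
    obtain ⟨l, hl⟩ := h3
    refine ⟨⟨(l + (9 * t + 2)).toNat, by omega⟩, ?_, ?_⟩
    · have : shortPos t ⟨(l + (9 * t + 2)).toNat, by omega⟩ = m := by
        simp only [shortPos]
        rw [if_neg (by omega)]
        omega
      rwa [this]
    · exact iff_of_true h (by simp only; omega)
  · refine ⟨⟨m.toNat, by omega⟩, ?_, ?_⟩
    · have : shortPos t ⟨m.toNat, by omega⟩ = m := by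
        simp only [shortPos]
        rw [if_pos (by omega)]
        omega
      rwa [this]
    · exact iff_of_false h (by simp only; omega)

/-- Every vertex of the long cycle occurs in every sufficiently long part of a walk. -/
theorem exists_mod_eq (p a b : ℤ) (hp : 0 < p) : ∃ τ, a ≤ τ ∧ τ < a + p ∧ p ∣ τ - b := by
  refine ⟨a + (b - a) % p, ?_, ?_, ?_⟩
  · have := Int.emod_nonneg (b - a) hp.ne'; omega
  · have := Int.emod_lt_of_pos (b - a) hp; omega
  · refine ⟨-((b - a) / p), ?_⟩
    have := Int.emod_add_mul_ediv (b - a) p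
    linarith

theorem exStrategy_cycle {t R : ℕ} (ht : 1 ≤ t)
    (hR : (2 * R : ℤ) + 2 * (3 * (4 * t + 1)) + 1 ≤ 3 * (4 * t + 1) * (3 * t + 1)) :
    ExStrategy (longCycle t) (shortCycle t) R (CycleSimilar t) where
  color_eq := by
    rintro r x y ⟨τ, -, -, h1, h2, h3⟩
    refine cycleColor_eq_iff.2 ⟨?_, decide_eq_decide.2 h3⟩
    have h1 := (dvd_mul_right (3 : ℤ) _).trans h1
    have h2 := (dvd_mul_right (3 : ℤ) _).trans h2
    simp only
    omega
  mono := by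
    rintro r x y ⟨τ, h1, h2, h⟩
    exact ⟨τ, by push_cast at h1; omega, by push_cast at h2; omega, h⟩
  start := by
    intro r hr x
    obtain ⟨τ, h1, h2, h3⟩ := exists_mod_eq (3 * (4 * t + 1)) (R + 1) (x : ℕ) (by positivity)
    obtain ⟨y, hy⟩ := exists_short t (τ := τ) (by omega) (by omega) h3
    exact ⟨y, τ, by omega, by omega, h3, hy⟩
  forth := by
    rintro r x y hr ⟨τ, h1, h2, h3, h4, h5⟩ x'
    push_cast at h1 h2
    by_cases hx : x = x'
    · subst hx
      exact ⟨y, ⟨τ, by omega, by omega, h3, h4, h5⟩, by simp, by simp⟩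
    have move : ∀ ε : ℤ, (ε = 1 ∨ ε = -1) → 3 * (4 * (t : ℤ) + 1) ∣ (x' : ℕ) - (x : ℕ) - ε →
        ∃ y', CycleSimilar t r x' y' ∧ (shortCycle t).graph.Adj y y' := by
      intro ε hε hd
      have h3' : 3 * (4 * (t : ℤ) + 1) ∣ (τ + ε) - (x' : ℕ) := by
        have := h3.sub hd; ring_nf at this ⊢; exact this
      obtain ⟨y', hy', hm⟩ := exists_short t (τ := τ + ε) (by omega) (by omega) h3'
      refine ⟨y', ⟨τ + ε, by omega, by omega, h3', hy', hm⟩, ?_⟩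
      have h6 := h4.sub hy'
      rcases hε with rfl | rfl
      · left; ring_nf at h6 ⊢; exact h6
      · right; rw [← dvd_neg]; ring_nf at h6 ⊢; exact h6
    by_cases hadj : (longCycle t).graph.Adj x x'
    · have : ∃ y', CycleSimilar t r x' y' ∧ (shortCycle t).graph.Adj y y' := by
        rcases hadj with h | h
        · exact move 1 (Or.inl rfl) h
        · refine move (-1) (Or.inr rfl) ?_
          rw [← dvd_neg]; ring_nf at h ⊢; exact h
      obtain ⟨y', hy', ha⟩ := this
      exact ⟨y', hy', iff_of_false hx ha.ne, iff_of_true hadj ha⟩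
    · obtain ⟨σ, g1, g2, g3⟩ :=
        exists_mod_eq (3 * (4 * t + 1)) (R + 1) (x' : ℕ) (by positivity)
      have g3' : 3 * (4 * (t : ℤ) + 1) ∣ (σ + 3 * (4 * t + 1)) - (x' : ℕ) := by
        have := g3.add (dvd_refl _); ring_nf at this ⊢; exact this
      obtain ⟨y₁, hy₁, hm₁⟩ := exists_short t (τ := σ) (by omega) (by omega) g3
      obtain ⟨y₂, hy₂, hm₂⟩ := exists_short t (τ := σ + 3 * (4 * t + 1)) (by omega) (by omega) g3'
      have hs₁ : CycleSimilar t r x' y₁ := ⟨σ, by omega, by omega, g3, hy₁, hm₁⟩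
      have hs₂ : CycleSimilar t r x' y₂ := ⟨σ + 3 * (4 * t + 1), by omega, by omega, g3', hy₂, hm₂⟩
      have near : ∀ z, y = z ∨ (shortCycle t).graph.Adj y z →
          ∃ ε : ℤ, (ε = 0 ∨ ε = 1 ∨ ε = -1) ∧
            3 * (3 * (t : ℤ) + 1) ∣ shortPos t z - shortPos t y - ε := by
        rintro z (rfl | h | h)
        · exact ⟨0, by simp, by simp⟩
        · exact ⟨1, by simp, h⟩
        · refine ⟨-1, by simp, ?_⟩
          rw [← dvd_neg]; ring_nf at h ⊢; exact h
      by_cases n₁ : y = y₁ ∨ (shortCycle t).graph.Adj y y₁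
      · by_cases n₂ : y = y₂ ∨ (shortCycle t).graph.Adj y y₂
        · exfalso
          obtain ⟨ε₁, e₁, d₁⟩ := near _ n₁
          obtain ⟨ε₂, e₂, d₂⟩ := near _ n₂
          have hd : 3 * (3 * (t : ℤ) + 1) ∣ 3 * (4 * t + 1) + (ε₁ - ε₂) := by
            have := (hy₂.sub hy₁).add (d₂.sub d₁)
            ring_nf at this ⊢; exact this
          have h3 := (dvd_mul_right (3 : ℤ) _).trans hd
          have : ε₁ = ε₂ := by omega
          rw [this, sub_self, add_zero] at hd
          have hd' : 3 * (3 * (t : ℤ) + 1) ∣ 3 * t := by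
            have := hd.sub (dvd_refl _); ring_nf at this ⊢; exact this
          have := Int.le_of_dvd (by omega) hd'
          omega
        · rw [not_or] at n₂
          exact ⟨y₂, hs₂, iff_of_false hx n₂.1, iff_of_false hadj n₂.2⟩
      · rw [not_or] at n₁
        exact ⟨y₁, hs₁, iff_of_false hx n₁.1, iff_of_false hadj n₁.2⟩

section Walks

variable {C V : Type}

/-- The formula saying that there is a walk of `n` steps from the variable `k` whose vertices
have the colors `f j, f (j + 1), …`. -/
def Formula.walk (f : ℕ → C) : ℕ → ℕ → Fin 2 → Formula C 2
  | 0, _, k => .atom (.eq k k)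
  | n + 1, j, k => .quant .ex (1 - k) (.and (.atom (.adj k (1 - k)))
      (.and (.atom (.col (f j) (1 - k))) (walk f n (j + 1) (1 - k))))

/-- There is a walk of `n` steps from `x` whose vertices have the colors `f j, f (j + 1), …`. -/
def HasWalk (G : ColoredGraph C V) (f : ℕ → C) : ℕ → ℕ → V → Prop
  | 0, _, _ => True
  | n + 1, j, x => ∃ y, G.graph.Adj x y ∧ G.color y = f j ∧ HasWalk G f n (j + 1) y

/-- The formula that tells the two labels of nodes at height `j` apart. -/
def Formula.node (f lev : ℕ → C) (N : ℕ) : ℕ → Fin 2 → Formula C 2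
  | 0, k => (walk f N 0 k).neg
  | j + 1, k => .quant .ex (1 - k) (.and (.atom (.adj k (1 - k)))
      (.and (.atom (.col (lev j) (1 - k))) (node f lev N j (1 - k)).neg))

/-- The property expressed by `Formula.node`. -/
def NodeProp (G : ColoredGraph C V) (f lev : ℕ → C) (N : ℕ) : ℕ → V → Prop
  | 0, x => ¬ HasWalk G f N 0 x
  | j + 1, x => ∃ y, G.graph.Adj x y ∧ G.color y = lev j ∧ ¬ NodeProp G f lev N j y

theorem ne_one_sub (k : Fin 2) : k ≠ 1 - k := by
  fin_cases k <;> simp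

theorem Formula.sat_walk (G : ColoredGraph C V) (f : ℕ → C) :
    ∀ (n j : ℕ) (k : Fin 2) (v : Fin 2 → V), (walk f n j k).Sat G v ↔ HasWalk G f n j (v k)
  | 0, _, _, _ => iff_of_true rfl trivial
  | n + 1, j, k, v => by
    refine exists_congr fun a => ?_
    simp only [Sat, Atom.Sat, sat_walk G f n, Function.update_self,
      Function.update_of_ne (ne_one_sub k)]

theorem Formula.sat_node (G : ColoredGraph C V) (f lev : ℕ → C) (N : ℕ) :
    ∀ (j : ℕ) (k : Fin 2) (v : Fin 2 → V),
      (node f lev N j k).Sat G v ↔ NodeProp G f lev N j (v k)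
  | 0, k, v => (sat_neg G _ v).trans (not_congr (sat_walk G f N 0 k v))
  | j + 1, k, v => by
    refine exists_congr fun a => ?_
    simp only [Sat, Atom.Sat, sat_neg, sat_node G f lev N j, Function.update_self,
      Function.update_of_ne (ne_one_sub k)]

theorem Formula.freeVars_walk (f : ℕ → C) :
    ∀ (n j : ℕ) (k : Fin 2), (walk f n j k).freeVars ⊆ {k}
  | 0, _, k => by simp [walk, freeVars, Atom.vars]
  | n + 1, j, k => by
    have := freeVars_walk f n (j + 1) (1 - k)
    intro x hx
    simp only [walk, freeVars, Atom.vars, Finset.mem_erase, Finset.mem_union, Finset.mem_insert,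
      Finset.mem_singleton] at hx
    obtain ⟨h1, (h | h) | h | h⟩ := hx
    · simpa using h
    · exact absurd h h1
    · exact absurd h h1
    · exact absurd (Finset.mem_singleton.1 (this h)) h1

theorem Formula.freeVars_node (f lev : ℕ → C) (N : ℕ) :
    ∀ (j : ℕ) (k : Fin 2), (node f lev N j k).freeVars ⊆ {k}
  | 0, k => by rw [node, freeVars_neg]; exact freeVars_walk f N 0 k
  | j + 1, k => by
    have := freeVars_node f lev N j (1 - k)
    intro x hx
    simp only [node, freeVars, freeVars_neg, Atom.vars, Finset.mem_erase, Finset.mem_union,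
      Finset.mem_insert, Finset.mem_singleton] at hx
    obtain ⟨h1, (h | h) | h | h⟩ := hx
    · simpa using h
    · exact absurd h h1
    · exact absurd h h1
    · exact absurd (Finset.mem_singleton.1 (this h)) h1

theorem Formula.alternations_walk (f : ℕ → C) :
    ∀ (n j : ℕ) (k : Fin 2), (walk f n j k).alternations .ex = 0
  | 0, _, _ => rfl
  | n + 1, j, k => by simp [walk, alternations, alternations_walk f n]

theorem Formula.alternations_node (f lev : ℕ → C) (N : ℕ) :
    ∀ (j : ℕ) (k : Fin 2), (node f lev N j k).alternations .all ≤ j ∧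
      (node f lev N (j + 1) k).alternations .ex ≤ j := by
  have step : ∀ (j : ℕ) (k : Fin 2), (node f lev N (j + 1) k).alternations .ex =
      (node f lev N j (1 - k)).alternations .all := by
    intro j k
    simp [node, alternations, alternations_neg, Quant.dual]
  have all : ∀ (j : ℕ) (k : Fin 2), (node f lev N j k).alternations .all ≤ j := by
    intro j
    induction j with
    | zero => intro k; simp [node, alternations_neg, Quant.dual, alternations_walk]
    | succ j ih =>
      intro k
      have h1 := alternations_dual_le (node f lev N (j + 1) k) .ex
      have h2 := ih (1 - k)
      rw [step] at h1
      exact h1.trans (Nat.succ_le_succ h2)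
  exact fun j k => ⟨all j k, (step j k).trans_le (all j _)⟩

/-- The sentence saying that some vertex of color `κ` satisfies `Formula.node` at height `i`. -/
def Formula.rootSentence (f lev : ℕ → C) (N i : ℕ) (κ : C) : Formula C 2 :=
  .quant .ex 0 (.and (.atom (.col κ 0)) (node f lev N i 0))

theorem Formula.isSentence_rootSentence (f lev : ℕ → C) (N i : ℕ) (κ : C) :
    (rootSentence f lev N i κ).IsSentence := by
  have := freeVars_node f lev N i 0
  refine Finset.eq_empty_of_forall_notMem fun x hx => ?_
  simp only [rootSentence, freeVars, Atom.vars, Finset.mem_erase, Finset.mem_union,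
    Finset.mem_singleton] at hx
  obtain ⟨h1, h | h⟩ := hx
  · exact h1 h
  · exact h1 (Finset.mem_singleton.1 (this h))

theorem Formula.rootSentence_mem (f lev : ℕ → C) (N : ℕ) {i : ℕ} (hi : 1 ≤ i) (κ : C) :
    rootSentence f lev N i κ ∈ sigmaFO C i 2 := by
  refine ⟨rfl, ?_⟩
  obtain ⟨i, rfl⟩ : ∃ i', i = i' + 1 := ⟨i - 1, by omega⟩
  have := (alternations_node f lev N i 0).2
  simp only [rootSentence, alternations, if_true]
  omega

theorem Formula.sat_rootSentence (G : ColoredGraph C V) (f lev : ℕ → C) (N i : ℕ) (κ : C)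
    (v : Fin 2 → V) :
    (rootSentence f lev N i κ).Sat G v ↔ ∃ x, G.color x = κ ∧ NodeProp G f lev N i x := by
  refine exists_congr fun a => ?_
  simp only [Sat, Atom.Sat, sat_node, Function.update_self]

end Walks

section Tree

variable {C Γ : Type} {base : Bool → ColoredGraph C Γ} {f lev : ℕ → C} {N : ℕ}

theorem exists_vert_succ {i : ℕ} {p : Vert Γ (i + 1) → Prop} :
    (∃ y, p y) ↔ p none ∨ ∃ c x, p (some (c, x)) :=
  Option.exists.trans (or_congr_right Prod.exists)

theorem hasWalk_tree_succ (i : ℕ) (b : Bool) {κ : C} (hκ : ∀ j, κ ≠ f j) (c : Fin 3) :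
    ∀ (n j : ℕ) (x : Vert Γ i), HasWalk (tree base lev (i + 1) b κ) f n j (some (c, x)) ↔
      HasWalk (tree base lev i (childLabel b c) (lev i)) f n j x
  | 0, _, _ => Iff.rfl
  | n + 1, j, x => by
    refine exists_vert_succ.trans ?_
    rw [or_iff_right fun h => hκ _ h.2.1]
    constructor
    · rintro ⟨d, y, ⟨h1, h2⟩, h3, h4⟩
      obtain rfl : c = d := h1
      exact ⟨y, h2, h3, (hasWalk_tree_succ i b hκ c n _ y).1 h4⟩
    · rintro ⟨y, h2, h3, h4⟩
      exact ⟨c, y, ⟨rfl, h2⟩, h3, (hasWalk_tree_succ i b hκ c n _ y).2 h4⟩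

theorem hasWalk_tree_zero (b : Bool) {κ : C} (hκ : ∀ j, κ ≠ f j) :
    ∀ (n j : ℕ) (x : Γ), HasWalk (tree base lev 0 b κ) f n j (some x) ↔ HasWalk (base b) f n j x
  | 0, _, _ => Iff.rfl
  | n + 1, j, x => by
    refine Option.exists.trans ?_
    rw [or_iff_right fun h => hκ _ h.2.1]
    exact exists_congr fun y => and_congr_right fun _ => and_congr_right fun _ =>
      hasWalk_tree_zero b hκ n _ y

theorem hasWalk_tree_zero_none (b : Bool) {κ : C} (hκ : ∀ j, κ ≠ f j) (n j : ℕ) :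
    HasWalk (tree base lev 0 b κ) f (n + 1) j none ↔
      ∃ x, (base b).color x = f j ∧ HasWalk (base b) f n (j + 1) x := by
  refine Option.exists.trans ?_
  rw [or_iff_right fun h => hκ _ h.2.1]
  exact exists_congr fun y => (and_iff_right trivial).trans <| and_congr_right fun _ =>
    hasWalk_tree_zero b hκ n _ y

theorem nodeProp_tree_succ (hf : ∀ j l, lev l ≠ f j) (i : ℕ) (b : Bool) {κ : C}
    (hκ : ∀ j, κ ≠ f j) (hκ' : ∀ k, lev (k + 1) = lev i → κ ≠ lev k) (c : Fin 3) :
    ∀ (j : ℕ) (x : Vert Γ i), treeColor base lev i (childLabel b c) (lev i) x = lev j →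
      (NodeProp (tree base lev (i + 1) b κ) f lev N j (some (c, x)) ↔
        NodeProp (tree base lev i (childLabel b c) (lev i)) f lev N j x)
  | 0, x, _ => not_congr (hasWalk_tree_succ i b hκ c N 0 x)
  | j + 1, x, hx => by
    refine exists_vert_succ.trans ?_
    rw [or_iff_right]
    · constructor
      · rintro ⟨d, y, ⟨h1, h2⟩, h3, h4⟩
        obtain rfl : c = d := h1
        exact ⟨y, h2, h3, fun h => h4 ((nodeProp_tree_succ hf i b hκ hκ' c j y h3).2 h)⟩
      · rintro ⟨y, h2, h3, h4⟩
        exact ⟨c, y, ⟨rfl, h2⟩, h3, fun h => h4 ((nodeProp_tree_succ hf i b hκ hκ' c j y h3).1 h)⟩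
    · rintro ⟨h1, h2, -⟩
      obtain rfl : x = none := h1
      have hx' : lev i = lev (j + 1) := by cases i <;> exact hx
      exact hκ' j hx'.symm h2

theorem nodeProp_tree_none (hf : ∀ j l, lev l ≠ f j)
    (hlev : ∀ j k, lev j = lev k ↔ j % 3 = k % 3)
    (hbase : ∀ b, (∃ x, (base b).color x = f 0 ∧ HasWalk (base b) f N 1 x) ↔ b = false) :
    ∀ (i : ℕ) (b : Bool) {κ : C}, (∀ j, κ ≠ f j) → (∀ k, lev (k + 2) = lev i → κ ≠ lev k) →
      (NodeProp (tree base lev i b κ) f lev (N + 1) i none ↔ b = true)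
  | 0, b, κ, hκ, _ => by
    refine (not_congr ((hasWalk_tree_zero_none b hκ N 0).trans (hbase b))).trans ?_
    simp
  | i + 1, b, κ, hκ, hκ' => by
    have hc : ∀ c, NodeProp (tree base lev (i + 1) b κ) f lev (N + 1) i (some (c, none)) ↔
        childLabel b c = true := fun c => by
      refine (nodeProp_tree_succ hf i b hκ (fun k hk => hκ' k ?_) c i none ?_).trans
        (nodeProp_tree_none hf hlev hbase i _ (hf · i) fun k hk hk' => ?_)
      · have := (hlev _ _).1 hk
        exact (hlev _ _).2 (by omega)
      · cases i <;> rfl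
      · have := (hlev _ _).1 hk
        have := (hlev _ _).1 hk'
        omega
    refine exists_vert_succ.trans ?_
    rw [or_iff_right fun h => (tree base lev (i + 1) b κ).graph.irrefl h.1]
    trans ∃ c, childLabel b c = false
    · refine exists_congr fun c => ⟨?_, fun h => ⟨none, rfl, ?_, ?_⟩⟩
      · rintro ⟨x, h1, -, h3⟩
        obtain rfl : x = none := h1
        rwa [hc, Bool.not_eq_true] at h3
      · cases i <;> rfl
      · rwa [hc, Bool.not_eq_true]
    · cases b <;> simp [childLabel]

end Tree

/-- The color of the vertex of the long cycle reached from its marked vertex by a walk of `j`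
steps. -/
def walkColor (t j : ℕ) : Fin 10 := cycleColor j (decide (12 * t + 3 ∣ j))

theorem hasWalk_longCycle (t : ℕ) :
    ∀ (n j : ℕ) (x : Fin (12 * t + 3)), j % (12 * t + 3) = x →
      HasWalk (longCycle t) (walkColor t) n (j + 1) x
  | 0, _, _, _ => trivial
  | n + 1, j, x, hx => by
    have hlt := Nat.mod_lt (j + 1) (show 0 < 12 * t + 3 by omega)
    refine ⟨⟨(j + 1) % (12 * t + 3), hlt⟩, Or.inl ?_, ?_, hasWalk_longCycle t n (j + 1) _ rfl⟩
    · have h1 := Nat.mod_add_div j (12 * t + 3)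
      have h2 := Nat.mod_add_div (j + 1) (12 * t + 3)
      rw [hx] at h1
      refine ⟨(j / (12 * t + 3) : ℕ) - ((j + 1) / (12 * t + 3) : ℕ), ?_⟩
      zify at h1 h2
      simp only
      push_cast
      linear_combination h2 - h1
    · refine cycleColor_eq_iff.2 ⟨?_, decide_eq_decide.2 Nat.dvd_iff_mod_eq_zero.symm⟩
      have h2 := Nat.mod_mod_of_dvd (j + 1) (show 3 ∣ 12 * t + 3 by omega)
      simp only
      omega

theorem exists_of_hasWalk_shortCycle (t : ℕ) (a : ℤ) (n' : ℕ) :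
    ∀ (n j : ℕ) (y : Fin (12 * t + 3)), (shortCycle t).color y = walkColor t j →
      3 * (3 * (t : ℤ) + 1) ∣ shortPos t y - (3 * a + j) →
      HasWalk (shortCycle t) (walkColor t) (n + n') (j + 1) y →
      ∃ y', (shortCycle t).color y' = walkColor t (j + n) ∧
        3 * (3 * (t : ℤ) + 1) ∣ shortPos t y' - (3 * a + (j + n : ℕ))
  | 0, j, y, hc, hy, _ => ⟨y, hc, hy⟩
  | n + 1, j, y, hc, hy, hw => by
    rw [Nat.add_right_comm] at hw
    obtain ⟨z, hz, hzc, hw⟩ := hw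
    have hz' : 3 * (3 * (t : ℤ) + 1) ∣ shortPos t z - (3 * a + (j + 1 : ℕ)) := by
      rcases hz with h | h
      · have := h.add hy
        push_cast
        ring_nf at this ⊢
        exact this
      · have h1 := (dvd_mul_right (3 : ℤ) _).trans h
        have h2 := (dvd_mul_right (3 : ℤ) _).trans hy
        have h3 := (cycleColor_eq_iff.1 hzc).1
        push_cast at h3
        omega
    obtain ⟨y', h1, h2⟩ := exists_of_hasWalk_shortCycle t a n' n (j + 1) z hzc hz' hw
    rw [show j + (n + 1) = j + 1 + n by omega]
    exact ⟨y', h1, h2⟩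

theorem shortPos_of_marked {t : ℕ} {y : Fin (12 * t + 3)} (h : 9 * t + 3 ≤ (y : ℕ)) :
    shortPos t y = 3 * ((y : ℕ) - (9 * t + 2)) := by
  rw [shortPos, if_neg (by omega)]

theorem marked_of_color {t j : ℕ} (hj : 12 * t + 3 ∣ j) {y : Fin (12 * t + 3)}
    (h : (shortCycle t).color y = walkColor t j) : 9 * t + 3 ≤ (y : ℕ) := by
  have := (cycleColor_eq_iff.1 h).2
  simpa [hj] using this

/-- A sufficiently long walk around the long cycle cannot be mapped to the short cycle. -/
theorem not_hasWalk_shortCycle (t : ℕ) (y : Fin (12 * t + 3))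
    (hy : (shortCycle t).color y = walkColor t 0) :
    ¬ HasWalk (shortCycle t) (walkColor t) (9 * t * (12 * t + 3)) 1 y := by
  intro hw
  have hm := marked_of_color (dvd_zero _) hy
  obtain ⟨a, ha⟩ : ∃ a, (y : ℕ) = 9 * t + 2 + a := ⟨y - (9 * t + 2), by omega⟩
  have hat : a ≤ 3 * t := by omega
  obtain ⟨n', hn'⟩ : ∃ n', 9 * t * (12 * t + 3) = 3 * a * (12 * t + 3) + n' :=
    Nat.exists_eq_add_of_le (Nat.mul_le_mul_right _ (by omega))
  rw [hn'] at hw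
  obtain ⟨y', h1, h2⟩ := exists_of_hasWalk_shortCycle t a n' _ 0 y hy
    (by rw [shortPos_of_marked hm, ha]; push_cast; ring_nf; exact dvd_zero _) hw
  have hm' := marked_of_color (by simp) h1
  rw [shortPos_of_marked hm'] at h2
  have h3 : 3 * (3 * (t : ℤ) + 1) ∣ 3 * ((y' : ℕ) - (9 * t + 2)) := by
    have := h2.add (dvd_mul_right (3 * (3 * (t : ℤ) + 1)) (4 * a))
    push_cast at this
    ring_nf at this ⊢
    exact this
  have := Int.le_of_dvd (by omega) h3
  omega

/-- The two gadgets. -/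
def gadget (t : ℕ) (b : Bool) : ColoredGraph (Fin 10) (Fin (12 * t + 3)) :=
  if b then shortCycle t else longCycle t

theorem exists_hasWalk_gadget (t : ℕ) (b : Bool) :
    (∃ x, (gadget t b).color x = walkColor t 0 ∧
      HasWalk (gadget t b) (walkColor t) (9 * t * (12 * t + 3)) 1 x) ↔ b = false := by
  cases b
  · refine iff_of_true ⟨⟨0, by omega⟩, ?_, ?_⟩ rfl
    · exact cycleColor_eq_iff.2 (by simp)
    · exact hasWalk_longCycle t _ 0 _ (by simp)
  · refine iff_of_false ?_ (by simp)
    rintro ⟨x, h1, h2⟩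
    exact not_hasWalk_shortCycle t x h1 h2

/-- The trees over the two cycles. -/
def cycleTree (t i : ℕ) (b : Bool) : ColoredGraph (Fin 10) (Vert (Fin (12 * t + 3)) i) :=
  tree (gadget t) levelColor i b 9

theorem treeColor_ne_nine (t : ℕ) :
    ∀ (i : ℕ) (b : Bool) {κ : Fin 10} (x : Vert (Fin (12 * t + 3)) i),
      (x = none → κ ≠ 9) → treeColor (gadget t) levelColor i b κ x ≠ 9
  | 0, _, _, none, h => h rfl
  | _ + 1, _, _, none, h => h rfl
  | 0, false, _, some _, _ => cycleColor_ne_nine _ _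
  | 0, true, _, some _, _ => cycleColor_ne_nine _ _
  | i + 1, _, _, some x, _ => treeColor_ne_nine t i _ x.2 fun _ => levelColor_ne_nine i

theorem distinguishable_cycleTree (t : ℕ) {i : ℕ} (hi : 1 ≤ i) :
    Distinguishable (sigmaFO (Fin 10) i 2) (cycleTree t i true) (cycleTree t i false) := by
  have hroot : ∀ b, NodeProp (cycleTree t i b) (walkColor t) levelColor
      (9 * t * (12 * t + 3) + 1) i none ↔ b = true := fun b =>
    nodeProp_tree_none (fun j l => (cycleColor_ne_levelColor _ _ _).symm)
      (fun _ _ => levelColor_eq_iff) (exists_hasWalk_gadget t) i b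
      (fun j => (cycleColor_ne_nine _ _).symm) (fun k _ => (levelColor_ne_nine k).symm)
  refine ⟨Formula.rootSentence (walkColor t) levelColor (9 * t * (12 * t + 3) + 1) i 9,
    Formula.rootSentence_mem _ _ _ hi _, Formula.isSentence_rootSentence _ _ _ _ _, ?_, ?_⟩
  · intro v
    exact (Formula.sat_rootSentence _ _ _ _ _ _ _).2
      ⟨none, by cases i <;> rfl, (hroot true).2 rfl⟩
  · intro h
    obtain ⟨x, hx, h⟩ := (Formula.sat_rootSentence _ _ _ _ _ _ _).1 (h fun _ => none)
    obtain rfl : x = none := by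
      by_contra hne
      exact treeColor_ne_nine t i false x (fun h => absurd h hne) hx
    simpa using (hroot false).1 h

end ColoredFO

theorem theorem6 :
    ∃ c : ℕ, ∀ i : ℕ, 1 ≤ i → ∀ N : ℕ, ∃ n : ℕ, N < n ∧
      ∃ G H : ColoredFO.ColoredGraph (Fin c) (Fin n),
        ColoredFO.Distinguishable (ColoredFO.sigmaFO (Fin c) i 2) G H ∧
        ∃ d : ℕ, ColoredFO.minDepth (ColoredFO.sigmaFO (Fin c) i 2) G H = (d : ℕ∞) ∧
          (d : ℝ) > 1 / (11 * 9 ^ i) * (n : ℝ) ^ 2 - 1 / (11 * 3 ^ i) * (n : ℝ) := by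
  refine ⟨10, fun i hi N => ?_⟩
  obtain ⟨t, htN⟩ : ∃ t, t = N + 3 := ⟨_, rfl⟩
  obtain ⟨hfin, hcard⟩ := ColoredFO.nat_card_vert (Fin (12 * t + 3)) i
  rw [Fintype.card_fin] at hcard
  have e : Fin (Nat.card (ColoredFO.Vert (Fin (12 * t + 3)) i)) ≃ _ := (Finite.equivFin _).symm
  set n := Nat.card (ColoredFO.Vert (Fin (12 * t + 3)) i) with hn
  have h3 : 1 ≤ 3 ^ i := Nat.one_le_pow _ _ (by omega)
  have hdist : ColoredFO.Distinguishable (ColoredFO.sigmaFO (Fin 10) i 2)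
      ((ColoredFO.cycleTree t i true).comap e) ((ColoredFO.cycleTree t i false).comap e) := by
    obtain ⟨φ, h1, h2⟩ := ColoredFO.distinguishable_cycleTree t hi
    exact ⟨φ, h1, (ColoredFO.Formula.distinguishes_comap e e _ _ φ).2 h2⟩
  obtain ⟨R, hR⟩ : ∃ R : ℕ, R + (2 * t + 2) = 18 * t ^ 2 :=
    ⟨18 * t ^ 2 - (2 * t + 2), Nat.sub_add_cancel (by nlinarith)⟩
  have hstrat := ColoredFO.exStrategy_cycle (t := t) (R := R) (by omega)
    (by zify at hR; nlinarith)
  obtain ⟨d, hd, hle⟩ := ColoredFO.exists_minDepth_eq hdist (R + 1) fun φ hφ h =>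
    ColoredFO.lt_depth_of_distinguishes_tree (base := ColoredFO.gadget t) hstrat hi 9 hφ
      ((ColoredFO.Formula.distinguishes_comap e e _ _ φ).1 h)
  refine ⟨n, by nlinarith, _, _, hdist, d, hd, ?_⟩
  have h9 : (9 : ℝ) ^ i = (3 ^ i) ^ 2 := by rw [← pow_mul, mul_comm, pow_mul]; norm_num
  have hp : (1 : ℝ) ≤ 3 ^ i := by exact_mod_cast h3
  obtain ⟨m, hm⟩ : ∃ m : ℝ, m = n / 3 ^ i := ⟨_, rfl⟩
  have hnm : (n : ℝ) = 3 ^ i * m := by rw [hm]; field_simp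
  have hcard' : 2 * (n : ℝ) + 1 = 3 ^ i * (2 * (12 * t + 3) + 3) := by exact_mod_cast hcard
  have hm1 : m ≤ 12 * t + 9 / 2 := by
    refine le_of_mul_le_mul_left (a := (3 : ℝ) ^ i) ?_ (by positivity)
    nlinarith
  have hm0 : 0 ≤ m := by rw [hm]; positivity
  have hval : 1 / (11 * 9 ^ i) * (n : ℝ) ^ 2 - 1 / (11 * 3 ^ i) * (n : ℝ) = (m ^ 2 - m) / 11 := by
    rw [h9, hnm]; field_simp
  rw [hval]
  have ht : (3 : ℝ) ≤ t := by rw [htN]; push_cast; linarith [(Nat.cast_nonneg N : (0 : ℝ) ≤ N)]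
  have hR' : (R : ℝ) + (2 * t + 2) = 18 * t ^ 2 := by exact_mod_cast hR
  have hle' : (R : ℝ) + 1 ≤ d := by exact_mod_cast hle
  have hmm : m ^ 2 - m ≤ (12 * t + 9 / 2) ^ 2 - (12 * t + 9 / 2) := by nlinarith
  nlinarith
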